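/- Let $p$ be an odd prime and let $F$ be a field of characteristic $0$. For a finite group $P$ and $C\subseteq P$ write $\overline{C}=\sum_{g\in C}g\in FP$. A Schur ring over $P$ is a subalgebra $S$ of the group algebra $FP$ for which there is a partition of $P$ into nonempty sets $T_1=\{1\},T_2,\dots,T_m$ such that $\overline{T_1},\dots,\overline{T_m}$ form a basis of $S$ and, for every $i$, the set $\{g^{-1}:g\in T_i\}$ is some $T_j$; the $\overline{T_i}$ (which are determined by $S$) are called the basic quantities of $S$. The Schur ring $S$ is rational if $\phi(x)=x$ for every $x\in S$ and every $\phi\in\mathrm{Aut}(P)$, where $\phi$ acts linearly on $FP$. The (algebraic) automorphism group $\mathrm{Aut}(S)$ consists of the $F$-algebra automorphisms of $S$ that map basic quantities to basic quantities. Theorem. For every finite group $\Gamma$ there are a finite abelian $p$-group $P$ and a rational Schur ring $S$ over $P$ (with coefficients in $F$) such that $\mathrm{Aut}(S)\cong\Gamma$. More precisely, one can take $P=Z_p\times Z_{p^3}\times\cdots\times Z_{p^{2n-1}}$ for some $n\ge 1$, and $S$ to be the $F$-linear span of $\{\overline{\iota(d)}: d\in D\}$, where $D$ is a finite distributive lattice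 with $\mathrm{Aut}(D)\cong\Gamma$ and $\iota$ is an injective lattice homomorphism from $D$ into the lattice of characteristic subgroups of $P$ that sends the least element of $D$ to $1$ and the greatest element of $D$ to $P$. -/

import Mathlib

noncomputable section

namespace SRing

open scoped Pointwise

/-- The simple quantity of a subset `C` of a finite group: the sum of the elements of `C`
in the group algebra. -/
def simpleQuantity (F : Type*) {G : Type*} [Field F] [Group G] [Finite G] (C : Set G) :
    MonoidAlgebra F G :=
  ∑ g ∈ C.toFinite.toFinset, MonoidAlgebra.single g 1

/-- A Schur ring over a finite group `G` with coefficients in the field `F`: a subalgebra of the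
group algebra having as a basis the simple quantities of a partition of `G` that is closed under
inversion and has `{1}` as a part. The partition is determined by the subalgebra (its parts are
the minimal nonempty sets whose simple quantity lies in it). -/
structure SchurRing (F G : Type*) [Field F] [Group G] [Finite G] where
  toSubalgebra : Subalgebra F (MonoidAlgebra F G)
  basicSets : Set (Set G)
  nonempty_of_mem : ∀ C ∈ basicSets, C.Nonempty
  pairwiseDisjoint : basicSets.PairwiseDisjoint id
  linearIndependent :
    LinearIndependent F (fun C : basicSets => simpleQuantity F (C : Set G))
  span_eq : Submodule.span F (simpleQuantity F '' basicSets) =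
    Subalgebra.toSubmodule toSubalgebra
  inv_mem : ∀ C ∈ basicSets, C⁻¹ ∈ basicSets
  singleton_one_mem : {1} ∈ basicSets
  sUnion_eq : ⋃₀ basicSets = Set.univ

namespace SchurRing

variable {F G G₁ G₂ : Type*} [Field F] [Group G] [Finite G] [Group G₁] [Finite G₁]
  [Group G₂] [Finite G₂]

theorem simpleQuantity_mem (S : SchurRing F G) {C : Set G} (hC : C ∈ S.basicSets) :
    simpleQuantity F C ∈ S.toSubalgebra := by
  rw [← Subalgebra.mem_toSubmodule, ← S.span_eq]
  exact Submodule.subset_span ⟨C, hC, rfl⟩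

/-- The basic quantity of a basic set, as an element of the Schur ring. -/
def basicQuantity (S : SchurRing F G) (C : S.basicSets) : S.toSubalgebra :=
  ⟨simpleQuantity F (C : Set G), S.simpleQuantity_mem C.2⟩

/-- A Schur ring is rational if each of its elements is fixed by every automorphism of `G`,
acting linearly on the group algebra. -/
def IsRational (S : SchurRing F G) : Prop :=
  ∀ x ∈ S.toSubalgebra, ∀ φ : MulAut G, MonoidAlgebra.mapDomain φ x = x

/-- (Algebraic) isomorphisms of Schur rings: algebra isomorphisms that map basic quantities to
basic quantities. -/
def IsIsomorphism (S₁ : SchurRing F G₁) (S₂ : SchurRing F G₂)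
    (φ : S₁.toSubalgebra ≃ₐ[F] S₂.toSubalgebra) : Prop :=
  ∀ C : S₁.basicSets, ∃ D : S₂.basicSets, φ (S₁.basicQuantity C) = S₂.basicQuantity D

/-- The (algebraic) automorphism group of a Schur ring, under composition. -/
def automorphismGroup (S : SchurRing F G) : Subgroup (S.toSubalgebra ≃ₐ[F] S.toSubalgebra) where
  carrier := {φ | IsIsomorphism S S φ}
  one_mem' := fun C => ⟨C, rfl⟩
  mul_mem' := by
    intro φ ψ hφ hψ C
    obtain ⟨D, hD⟩ := hψ C
    obtain ⟨E, hE⟩ := hφ D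
    exact ⟨E, by rw [AlgEquiv.mul_apply, hD, hE]⟩
  inv_mem' := by
    intro φ hφ
    have hφ' : ∀ C, ∃ D, φ (S.basicQuantity C) = S.basicQuantity D := hφ
    choose f hf using hφ'
    have hq : Function.Injective S.basicQuantity := by
      intro C D h
      exact S.linearIndependent.injective (congrArg Subtype.val h)
    have hinj : Function.Injective f := by
      intro C D h
      apply hq
      apply φ.injective
      rw [hf, hf, h]
    intro C
    obtain ⟨D, hD⟩ := Finite.surjective_of_injective hinj C
    refine ⟨D, ?_⟩
    rw [← hD, ← hf]
    exact φ.symm_apply_apply _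

end SchurRing

/-- The group `Z_p × Z_{p^3} × ⋯ × Z_{p^{2n-1}}`, written multiplicatively. -/
abbrev OddPowerGroup (p n : ℕ) : Type :=
  (i : Fin n) → Multiplicative (ZMod (p ^ (2 * (i : ℕ) + 1)))

end SRing

end

/-! For subgroups H, K of an abelian group, the product of their sums is |H ∩ K| times the sum of HK
(`simpleQuantity_subgroup_mul`), so a lattice of subgroups spans a subalgebra. If every layer (the
members of ι d lying in no smaller subgroup) is nonempty, the layers are the basic sets, indexed by
D. An automorphism σ of D permutes them, and this is multiplicative once |ι (σ d)| = |ι d|.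
Conversely, for odd p the square of the sum of layer d has support exactly ι d, so an algebra
automorphism permuting the basic quantities preserves the order of D. Hence Aut(S) ≅ Aut(D).

It remains to find D with Aut(D) ≅ Γ, embedded so that its automorphisms preserve subgroup orders. Γ
is the automorphism group of a finite bounded poset Y (`CayleyPoset`), and the lattice D of lower
sets has the same automorphisms, since Y is recovered as its sup-irreducibles. A box of elements
with i-th coordinate killed by p^(a i) is characteristic if 0 ≤ a j - a i ≤ 2(j - i) for i < j.
Counting coordinates from 0, a lower set containing ⊥ but not ⊤ gets exponent i or i + 1, recording
whether it contains the i-th inner element of Y; the steps of 2 make these choices independent. The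
order of the box depends only on the size of the lower set, so automorphisms preserve it. -/

noncomputable section

namespace SRing

open scoped Classical Pointwise

/-! ### Sums over subsets and subgroups in the group algebra -/

section SimpleQuantity

variable {F G : Type*} [Field F] [Group G] [Finite G]

theorem coeff_simpleQuantity (C : Set G) (x : G) :
    (simpleQuantity F C).coeff x = if x ∈ C then 1 else 0 := by
  simp [simpleQuantity, MonoidAlgebra.coeff_sum, Finsupp.finsetSum_apply, Finsupp.single_apply]

theorem coeff_simpleQuantity_mul (C D : Set G) (x : G) :
    (simpleQuantity F C * simpleQuantity F D).coeff x =
      ({g | g ∈ C ∧ g⁻¹ * x ∈ D}.ncard : F) := by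
  have h : ∀ g : G, (MonoidAlgebra.single g (1 : F) * simpleQuantity F D).coeff x =
      if g⁻¹ * x ∈ D then 1 else 0 := by
    intro g
    rw [MonoidAlgebra.coeff_single_mul_eq_mul_coeff (g⁻¹ * x), coeff_simpleQuantity, one_mul]
    intro m _
    exact eq_inv_mul_iff_mul_eq.symm
  rw [simpleQuantity, Finset.sum_mul, MonoidAlgebra.coeff_sum, Finsupp.finsetSum_apply,
    Finset.sum_congr rfl fun g _ => h g, Finset.sum_boole, ← Set.ncard_coe_finset]
  congr 2
  ext g
  simp

theorem mapDomain_simpleQuantity (φ : MulAut G) {C : Set G} (hC : ∀ g, φ g ∈ C ↔ g ∈ C) :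
    MonoidAlgebra.mapDomain φ (simpleQuantity F C) = simpleQuantity F C := by
  ext x
  obtain ⟨y, rfl⟩ := φ.surjective x
  rw [coeff_simpleQuantity, MonoidAlgebra.coeff_mapDomain, Finsupp.mapDomain_apply φ.injective,
    coeff_simpleQuantity]
  simp [hC]

/-- If x = hk, the first factors of all such factorisations of x form the coset h(H ∩ K). -/
theorem simpleQuantity_subgroup_mul {G : Type*} [CommGroup G] [Finite G] (H K : Subgroup G) :
    simpleQuantity F (H : Set G) * simpleQuantity F (K : Set G) =
      (Nat.card (H ⊓ K : Subgroup G) : F) • simpleQuantity F ((H ⊔ K : Subgroup G) : Set G) := by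
  ext x
  rw [coeff_simpleQuantity_mul, MonoidAlgebra.coeff_smul_apply, coeff_simpleQuantity]
  split_ifs with hx
  · obtain ⟨h, hh, k, hk, rfl⟩ := Subgroup.mem_sup.1 hx
    rw [smul_eq_mul, mul_one, ← Nat.card_coe_set_eq]
    congr 1
    refine Nat.card_congr ((Equiv.mulLeft h⁻¹).subtypeEquiv fun g => ?_)
    have h1 : g ∈ H ↔ h⁻¹ * g ∈ H := (Subgroup.mul_mem_cancel_left H (H.inv_mem hh)).symm
    have h2 : g⁻¹ * (h * k) ∈ K ↔ h⁻¹ * g ∈ K := by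
      rw [← mul_assoc, Subgroup.mul_mem_cancel_right K hk, ← Subgroup.inv_mem_iff]
      simp
    simp only [Set.mem_ofPred_eq, SetLike.mem_coe, Equiv.coe_mulLeft]
    rw [h2, h1]
    exact Subgroup.mem_inf.symm
  · rw [smul_zero]
    have : {g | g ∈ (H : Set G) ∧ g⁻¹ * x ∈ (K : Set G)} = ∅ := by
      ext g
      simp only [Set.mem_ofPred_eq, SetLike.mem_coe, Set.mem_empty_iff_false, iff_false]
      rintro ⟨hg, hgx⟩
      exact hx (Subgroup.mem_sup.2 ⟨g, hg, _, hgx, by simp⟩)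
    rw [this]
    simp

theorem linearIndependent_simpleQuantity {ι : Type*} (T : ι → Set G)
    (hne : ∀ i, (T i).Nonempty) (hd : ∀ i j g, g ∈ T i → g ∈ T j → i = j) :
    LinearIndependent F fun i => simpleQuantity F (T i) := by
  rw [linearIndependent_iff']
  intro s c hc i hi
  obtain ⟨g, hg⟩ := hne i
  have := congrArg (fun y => MonoidAlgebra.coeff y g) hc
  simp only [MonoidAlgebra.coeff_sum, Finsupp.finsetSum_apply, MonoidAlgebra.coeff_smul_apply,
    coeff_simpleQuantity, MonoidAlgebra.coeff_zero, Finsupp.coe_zero, Pi.zero_apply] at this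
  rw [Finset.sum_eq_single i] at this
  · simpa [hg] using this
  · intro j _ hj
    rw [if_neg fun h => hj (hd _ _ _ h hg), smul_zero]
  · exact fun h => absurd hi h

end SimpleQuantity

/-! ### The Schur ring of a lattice of subgroups -/

section Layer

variable {G D : Type*} [CommGroup G] [DistribLattice D] [BoundedOrder D]

/-- The elements `g` for which `d` is the least element of the lattice whose image contains `g`. -/
def layer (ι : BoundedLatticeHom D (Subgroup G)) (d : D) : Set G :=
  {g | ∀ e, g ∈ ι e ↔ d ≤ e}

variable (ι : BoundedLatticeHom D (Subgroup G))

theorem eq_of_mem_layer {d e : D} {g : G} (hd : g ∈ layer ι d) (he : g ∈ layer ι e) : d = e :=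
  le_antisymm ((hd e).1 ((he e).2 le_rfl)) ((he d).1 ((hd d).2 le_rfl))

/-- Meets go to intersections, so the infimum of all e with g ∈ ι e is itself such an e. -/
theorem exists_mem_layer [Finite D] (g : G) : ∃ d, g ∈ layer ι d := by
  have := Fintype.ofFinite D
  have hmono : Monotone ι := OrderHomClass.mono ι
  refine ⟨(Finset.univ.filter fun e => g ∈ ι e).inf id, fun e => ⟨fun he => ?_, fun he => ?_⟩⟩
  · exact Finset.inf_le (f := id) (by simpa using he)
  · refine hmono he ?_
    rw [map_finset_inf]
    refine Finset.inf_induction (p := fun H : Subgroup G => g ∈ H) (Subgroup.mem_top g)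
      (fun H hH K hK => ⟨hH, hK⟩) fun d hd => ?_
    simpa using hd

theorem layer_bot : layer ι ⊥ = {1} := by
  ext g
  constructor
  · intro hg
    have := (hg ⊥).2 le_rfl
    rwa [map_bot, Subgroup.mem_bot] at this
  · rintro rfl e
    simp [one_mem]

theorem injective_of_layer_nonempty (hne : ∀ d, (layer ι d).Nonempty) : Function.Injective ι := by
  have h : ∀ d e, ι d = ι e → d ≤ e := by
    intro d e hde
    obtain ⟨g, hg⟩ := hne d
    exact (hg e).1 (hde ▸ (hg d).2 le_rfl)
  exact fun d e hde => le_antisymm (h d e hde) (h e d hde.symm)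

variable (F : Type*) [Field F] [Finite G]

theorem simpleQuantity_eq_sum_layer [Fintype D] (d : D) :
    simpleQuantity F (ι d : Set G) =
      ∑ e ∈ Finset.univ.filter (· ≤ d), simpleQuantity F (layer ι e) := by
  ext x
  obtain ⟨e, he⟩ := exists_mem_layer ι x
  have h : ∀ f, x ∈ layer ι f ↔ e = f :=
    fun f => ⟨fun hf => eq_of_mem_layer ι he hf, fun hf => hf ▸ he⟩
  simp only [MonoidAlgebra.coeff_sum, Finsupp.finsetSum_apply, coeff_simpleQuantity, h,
    SetLike.mem_coe, he d]
  simp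

/-- The change between layers and subgroups is unitriangular for the order of D. -/
theorem span_layer [Finite D] :
    Submodule.span F (Set.range fun d => simpleQuantity F (layer ι d)) =
      Submodule.span F (Set.range fun d => simpleQuantity F (ι d : Set G)) := by
  have := Fintype.ofFinite D
  apply le_antisymm
  · rw [Submodule.span_le]
    rintro _ ⟨d, rfl⟩
    induction d using WellFoundedLT.induction with
    | ind d ih =>
      have h := simpleQuantity_eq_sum_layer ι F d
      rw [← Finset.sum_erase_add _ _ (show d ∈ Finset.univ.filter (· ≤ d) by simp)] at h
      rw [← sub_eq_iff_eq_add'] at h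
      simp only
      rw [← h]
      refine Submodule.sub_mem _ (Submodule.subset_span ⟨d, rfl⟩)
        (Submodule.sum_mem _ fun e he => ih e ?_)
      simp only [Finset.mem_erase, Finset.mem_filter, Finset.mem_univ, true_and] at he
      exact lt_of_le_of_ne he.2 he.1
  · rw [Submodule.span_le]
    rintro _ ⟨d, rfl⟩
    simp only [simpleQuantity_eq_sum_layer ι F d]
    exact Submodule.sum_mem _ fun e _ => Submodule.subset_span ⟨e, rfl⟩

/-- The span of the simple quantities of the subgroups in the image of a lattice homomorphism
is a subalgebra of the group algebra. -/
def latticeSubalgebra : Subalgebra F (MonoidAlgebra F G) :=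
  (Submodule.span F (Set.range fun d => simpleQuantity F (ι d : Set G))).toSubalgebra
    (by
      refine Submodule.subset_span ⟨⊥, ?_⟩
      ext x
      simp [coeff_simpleQuantity, MonoidAlgebra.one_def, Finsupp.single_apply, eq_comm])
    (by
      intro x y hx hy
      have := Submodule.mul_mem_mul hx hy
      rw [Submodule.span_mul_span] at this
      refine Submodule.span_le.2 ?_ this
      rintro _ ⟨_, ⟨d, rfl⟩, _, ⟨e, rfl⟩, rfl⟩
      simp only [simpleQuantity_subgroup_mul, ← map_sup]
      exact Submodule.smul_mem _ _ (Submodule.subset_span ⟨d ⊔ e, rfl⟩))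

theorem toSubmodule_latticeSubalgebra :
    Subalgebra.toSubmodule (latticeSubalgebra ι F) =
      Submodule.span F (Set.range fun d => simpleQuantity F (ι d : Set G)) :=
  Submodule.toSubalgebra_toSubmodule _ _ _

variable [Finite D]

/-- The Schur ring spanned by the simple quantities of a lattice of subgroups none of whose
members is covered by smaller members. -/
def latticeSchurRing (hne : ∀ d, (layer ι d).Nonempty) : SchurRing F G where
  toSubalgebra := latticeSubalgebra ι F
  basicSets := Set.range (layer ι)
  nonempty_of_mem := by
    rintro _ ⟨d, rfl⟩
    exact hne d
  pairwiseDisjoint := by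
    rintro _ ⟨d, rfl⟩ _ ⟨e, rfl⟩ hde
    refine Set.disjoint_left.2 fun g hd he => hde ?_
    rw [eq_of_mem_layer ι hd he]
  linearIndependent := by
    refine linearIndependent_simpleQuantity _ ?_ ?_
    · rintro ⟨_, d, rfl⟩
      exact hne d
    · rintro ⟨_, d, rfl⟩ ⟨_, e, rfl⟩ g hd he
      cases eq_of_mem_layer ι hd he
      rfl
  span_eq := by
    rw [toSubmodule_latticeSubalgebra, ← span_layer, ← Set.range_comp]
    rfl
  inv_mem := by
    rintro _ ⟨d, rfl⟩
    refine ⟨d, ?_⟩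
    ext g
    simp [layer]
  singleton_one_mem := ⟨⊥, layer_bot ι⟩
  sUnion_eq := by
    refine Set.eq_univ_of_forall fun g => ?_
    obtain ⟨d, hd⟩ := exists_mem_layer ι g
    exact ⟨_, ⟨d, rfl⟩, hd⟩

theorem isRational_latticeSchurRing (hne : ∀ d, (layer ι d).Nonempty)
    (hchar : ∀ d, (ι d).Characteristic) :
    (latticeSchurRing ι F hne).IsRational := by
  intro x hx φ
  replace hx : x ∈ Submodule.span F (Set.range fun d => simpleQuantity F (ι d : Set G)) := by
    rwa [← toSubmodule_latticeSubalgebra]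
  induction hx using Submodule.span_induction with
  | mem x hx =>
    obtain ⟨d, rfl⟩ := hx
    refine mapDomain_simpleQuantity φ fun g => ?_
    have := (hchar d).fixed φ
    exact SetLike.ext_iff.1 this g
  | zero => exact MonoidAlgebra.mapDomain_zero _
  | add x y _ _ hx hy => rw [MonoidAlgebra.mapDomain_add, hx, hy]
  | smul a x _ hx => rw [MonoidAlgebra.mapDomain_smul, hx]

end Layer
end SRing
end

noncomputable section

namespace SRing

open scoped Classical Pointwise

/-! ### Automorphisms of the Schur ring and of the lattice -/

section Automorphisms

variable {G D : Type*} [CommGroup G] [Finite G] [DistribLattice D] [BoundedOrder D] [Finite D]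
  (ι : BoundedLatticeHom D (Subgroup G)) (F : Type*) [Field F]
  (hne : ∀ d, (layer ι d).Nonempty)

/-- The basis of the Schur ring of a lattice of subgroups formed by the basic quantities. -/
def layerBasis : Module.Basis D F (latticeSchurRing ι F hne).toSubalgebra :=
  Module.Basis.mk
    (v := fun d => (latticeSchurRing ι F hne).basicQuantity ⟨layer ι d, ⟨d, rfl⟩⟩)
    (by
      refine LinearIndependent.of_comp (latticeSchurRing ι F hne).toSubalgebra.val.toLinearMap ?_
      exact linearIndependent_simpleQuantity (layer ι) hne fun i j g => eq_of_mem_layer ι)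
    (by
      rintro ⟨x, hx⟩ -
      have h : x ∈ Submodule.span F (Set.range fun d => simpleQuantity F (layer ι d)) := by
        rw [span_layer, ← toSubmodule_latticeSubalgebra]
        exact hx
      rw [← Submodule.apply_mem_span_image_iff_mem_span
        (f := (latticeSchurRing ι F hne).toSubalgebra.val.toLinearMap) Subtype.val_injective,
        ← Set.range_comp]
      exact h)

theorem layerBasis_apply (d : D) :
    layerBasis ι F hne d = (latticeSchurRing ι F hne).basicQuantity ⟨layer ι d, ⟨d, rfl⟩⟩ :=
  Module.Basis.mk_apply _ _ _

theorem coe_layerBasis_apply (d : D) :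
    (layerBasis ι F hne d : MonoidAlgebra F G) = simpleQuantity F (layer ι d) := by
  rw [layerBasis_apply]
  rfl

theorem layerBasis_repr_apply (y : (latticeSchurRing ι F hne).toSubalgebra) {d : D} {g : G}
    (hg : g ∈ layer ι d) :
    (layerBasis ι F hne).repr y d = (y : MonoidAlgebra F G).coeff g := by
  have := Fintype.ofFinite D
  conv_rhs => rw [← (layerBasis ι F hne).sum_repr y]
  have h : ∀ e, g ∈ layer ι e ↔ e = d :=
    fun e => ⟨fun he => eq_of_mem_layer ι he hg, fun he => he ▸ hg⟩
  simp [-Module.Basis.sum_repr, MonoidAlgebra.coeff_sum, Finsupp.finsetSum_apply, coe_layerBasis_apply,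
    coeff_simpleQuantity, h]

/-- The simple quantity of a member of the lattice as an element of the Schur ring. -/
def subgroupQuantity (d : D) : (latticeSchurRing ι F hne).toSubalgebra :=
  ⟨simpleQuantity F (ι d : Set G), by
    change _ ∈ Subalgebra.toSubmodule (latticeSubalgebra ι F)
    rw [toSubmodule_latticeSubalgebra]
    exact Submodule.subset_span ⟨d, rfl⟩⟩

theorem subgroupQuantity_eq_sum [Fintype D] (d : D) :
    subgroupQuantity ι F hne d = ∑ e ∈ Finset.univ.filter (· ≤ d), layerBasis ι F hne e := by
  apply Subtype.ext
  simp [subgroupQuantity, simpleQuantity_eq_sum_layer ι F d, coe_layerBasis_apply]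

theorem subgroupQuantity_mul (d e : D) :
    subgroupQuantity ι F hne d * subgroupQuantity ι F hne e =
      (Nat.card (ι (d ⊓ e)) : F) • subgroupQuantity ι F hne (d ⊔ e) := by
  apply Subtype.ext
  simp [subgroupQuantity, simpleQuantity_subgroup_mul]

theorem subgroupQuantity_bot : subgroupQuantity ι F hne ⊥ = 1 := by
  apply Subtype.ext
  ext x
  simp [subgroupQuantity, coeff_simpleQuantity, MonoidAlgebra.one_def, Finsupp.single_apply,
    eq_comm]

theorem span_subgroupQuantity :
    Submodule.span F (Set.range (subgroupQuantity ι F hne)) = ⊤ := by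
  rw [eq_top_iff]
  rintro ⟨x, hx⟩ -
  rw [← Submodule.apply_mem_span_image_iff_mem_span
    (f := (latticeSchurRing ι F hne).toSubalgebra.val.toLinearMap) Subtype.val_injective,
    ← Set.range_comp]
  change x ∈ Subalgebra.toSubmodule (latticeSubalgebra ι F) at hx
  rw [toSubmodule_latticeSubalgebra] at hx
  exact hx

/-- The linear automorphism of the Schur ring that permutes the basic quantities as an
automorphism of the lattice does. -/
def layerLinearEquiv (σ : D ≃o D) :
    (latticeSchurRing ι F hne).toSubalgebra ≃ₗ[F] (latticeSchurRing ι F hne).toSubalgebra :=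
  (layerBasis ι F hne).equiv (layerBasis ι F hne) σ.toEquiv

theorem layerLinearEquiv_layerBasis (σ : D ≃o D) (d : D) :
    layerLinearEquiv ι F hne σ (layerBasis ι F hne d) = layerBasis ι F hne (σ d) :=
  Module.Basis.equiv_apply _ _ _ _

/-- σ carries the elements below d onto those below σ d. -/
theorem layerLinearEquiv_subgroupQuantity (σ : D ≃o D) (d : D) :
    layerLinearEquiv ι F hne σ (subgroupQuantity ι F hne d) = subgroupQuantity ι F hne (σ d) := by
  have := Fintype.ofFinite D
  rw [subgroupQuantity_eq_sum, subgroupQuantity_eq_sum, map_sum]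
  refine Finset.sum_equiv σ.toEquiv (fun e => by simp) fun e _ => ?_
  exact layerLinearEquiv_layerBasis ι F hne σ e

variable {ι} in
/-- The algebra automorphism of the Schur ring induced by an automorphism of the lattice that
preserves orders of subgroups. -/
def layerAlgEquiv (hcard : ∀ (σ : D ≃o D) d, Nat.card (ι (σ d)) = Nat.card (ι d)) (σ : D ≃o D) :
    (latticeSchurRing ι F hne).toSubalgebra ≃ₐ[F] (latticeSchurRing ι F hne).toSubalgebra :=
  AlgEquiv.ofLinearEquiv (layerLinearEquiv ι F hne σ)
    (by rw [← subgroupQuantity_bot ι F hne, layerLinearEquiv_subgroupQuantity, map_bot])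
    (by
      intro x y
      have hx : x ∈ Submodule.span F (Set.range (subgroupQuantity ι F hne)) := by
        rw [span_subgroupQuantity]; trivial
      have hy : y ∈ Submodule.span F (Set.range (subgroupQuantity ι F hne)) := by
        rw [span_subgroupQuantity]; trivial
      -- For subgroup sums the product involves only joins, meets and subgroup orders, all respected
      -- by σ.
      induction hx, hy using Submodule.span_induction₂ with
      | mem_mem x y hx hy =>
        obtain ⟨d, rfl⟩ := hx
        obtain ⟨e, rfl⟩ := hy
        simp only [subgroupQuantity_mul, map_smul, layerLinearEquiv_subgroupQuantity]
        rw [map_sup, ← map_inf, hcard]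
      | zero_left y hy => simp
      | zero_right x hx => simp
      | add_left x y z _ _ _ hx hy => rw [add_mul, map_add, hx, hy, map_add, add_mul]
      | add_right x y z _ _ _ hx hy => rw [mul_add, map_add, hx, hy, map_add, mul_add]
      | smul_left r x y _ _ h => rw [smul_mul_assoc, map_smul, h, map_smul, smul_mul_assoc]
      | smul_right r x y _ _ h => rw [mul_smul_comm, map_smul, h, map_smul, mul_smul_comm])

theorem layerAlgEquiv_layerBasis
    (hcard : ∀ (σ : D ≃o D) d, Nat.card (ι (σ d)) = Nat.card (ι d)) (σ : D ≃o D) (d : D) :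
    layerAlgEquiv F hne hcard σ (layerBasis ι F hne d) = layerBasis ι F hne (σ d) :=
  layerLinearEquiv_layerBasis ι F hne σ d

variable {ι} in
/-- The homomorphism from the automorphism group of a lattice of subgroups to the automorphism
group of its Schur ring. -/
def automorphismHom (hcard : ∀ (σ : D ≃o D) d, Nat.card (ι (σ d)) = Nat.card (ι d)) :
    (D ≃o D) →* (latticeSchurRing ι F hne).automorphismGroup :=
  MonoidHom.mk' (fun σ => ⟨layerAlgEquiv F hne hcard σ, by
    rintro ⟨_, d, rfl⟩
    refine ⟨⟨layer ι (σ d), ⟨_, rfl⟩⟩, ?_⟩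
    rw [← layerBasis_apply, ← layerBasis_apply, layerAlgEquiv_layerBasis]⟩) (by
    intro σ τ
    apply Subtype.ext
    apply AlgEquiv.toLinearMap_injective
    refine (layerBasis ι F hne).ext fun d => ?_
    change layerAlgEquiv F hne hcard (σ * τ) (layerBasis ι F hne d) =
      layerAlgEquiv F hne hcard σ (layerAlgEquiv F hne hcard τ (layerBasis ι F hne d))
    simp only [layerAlgEquiv_layerBasis]
    rfl)

theorem injective_automorphismHom
    (hcard : ∀ (σ : D ≃o D) d, Nat.card (ι (σ d)) = Nat.card (ι d)) :
    Function.Injective (automorphismHom F hne hcard) := by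
  intro σ τ h
  ext d
  have h1 : layerAlgEquiv F hne hcard σ (layerBasis ι F hne d) =
      layerAlgEquiv F hne hcard τ (layerBasis ι F hne d) :=
    DFunLike.congr_fun (congrArg Subtype.val h) _
  rw [layerAlgEquiv_layerBasis, layerAlgEquiv_layerBasis] at h1
  exact (layerBasis ι F hne).injective h1

/-- The coefficient counts factorisations of an element x of layer e into two elements of layer d.
There are none unless x ∈ ι d, and then `hgen` gives one; characteristic 0 keeps the count nonzero.
Thus multiplication determines the order of D. -/
theorem layerBasis_repr_mul_self_ne_zero_iff [CharZero F]
    (hgen : ∀ d, ∀ x ∈ ι d, ∃ g ∈ layer ι d, g⁻¹ * x ∈ layer ι d) (d e : D) :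
    (layerBasis ι F hne).repr (layerBasis ι F hne d * layerBasis ι F hne d) e ≠ 0 ↔ e ≤ d := by
  obtain ⟨x, hx⟩ := hne e
  rw [layerBasis_repr_apply ι F hne _ hx, MulMemClass.coe_mul, coe_layerBasis_apply,
    coeff_simpleQuantity_mul, Nat.cast_ne_zero, ← Nat.pos_iff_ne_zero, Set.ncard_pos, ← hx d]
  constructor
  · rintro ⟨g, hg, hgx⟩
    have := (ι d).mul_mem ((hg d).2 le_rfl) ((hgx d).2 le_rfl)
    rwa [mul_inv_cancel_left] at this
  · intro h
    obtain ⟨g, hg, hgx⟩ := hgen d x h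
    exact ⟨g, hg, hgx⟩

theorem surjective_automorphismHom [CharZero F]
    (hcard : ∀ (σ : D ≃o D) d, Nat.card (ι (σ d)) = Nat.card (ι d))
    (hgen : ∀ d, ∀ x ∈ ι d, ∃ g ∈ layer ι d, g⁻¹ * x ∈ layer ι d) :
    Function.Surjective (automorphismHom F hne hcard) := by
  have := Fintype.ofFinite D
  rintro ⟨φ, hφ⟩
  have h : ∀ d, ∃ e, φ (layerBasis ι F hne d) = layerBasis ι F hne e := by
    intro d
    obtain ⟨⟨_, e, rfl⟩, he⟩ := hφ ⟨layer ι d, ⟨d, rfl⟩⟩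
    refine ⟨e, ?_⟩
    rw [layerBasis_apply, layerBasis_apply, he]
  choose f hf using h
  have hinj : Function.Injective f := by
    intro d e hde
    apply (layerBasis ι F hne).injective
    apply φ.injective
    rw [hf, hf, hde]
  have hrepr : ∀ y e, (layerBasis ι F hne).repr (φ y) (f e) = (layerBasis ι F hne).repr y e := by
    intro y e
    conv_lhs => rw [← (layerBasis ι F hne).sum_repr y]
    simp only [map_sum, map_smul, hf, Module.Basis.repr_self, Finsupp.finsetSum_apply,
      Finsupp.smul_apply, Finsupp.single_apply, hinj.eq_iff]
    simp
  have hle : ∀ d e, f e ≤ f d ↔ e ≤ d := by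
    intro d e
    rw [← layerBasis_repr_mul_self_ne_zero_iff ι F hne hgen d e, ← hrepr, map_mul, hf,
      layerBasis_repr_mul_self_ne_zero_iff ι F hne hgen]
  refine ⟨⟨Equiv.ofBijective f (Finite.injective_iff_bijective.1 hinj), fun {a b} => hle b a⟩, ?_⟩
  apply Subtype.ext
  apply AlgEquiv.toLinearMap_injective
  refine (layerBasis ι F hne).ext fun d => ?_
  exact (layerAlgEquiv_layerBasis ι F hne hcard _ d).trans (hf d).symm

end Automorphisms
end SRing
end

noncomputable section

namespace SRing

/-! ### Elements of given order in cyclic p-groups -/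

section CyclicPGroup

variable {p : ℕ} [Fact p.Prime] {K : Type*} [CommGroup K] [IsCyclic K] {m : ℕ}

theorem exists_orderOf_eq_prime_pow (hK : Nat.card K = p ^ m) {a : ℕ} (ha : a ≤ m) :
    ∃ u : K, orderOf u = p ^ a := by
  have hp := Fact.out (p := p.Prime)
  obtain ⟨g, hg⟩ := IsCyclic.exists_ofOrder_eq_natCard (α := K)
  have hm : p ^ m = p ^ (m - a) * p ^ a := by rw [← pow_add, Nat.sub_add_cancel ha]
  refine ⟨g ^ p ^ (m - a), ?_⟩
  rw [orderOf_pow_of_dvd (pow_ne_zero _ hp.ne_zero) (by rw [hg, hK, hm]; exact dvd_mul_right _ _),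
    hg, hK, hm, Nat.mul_div_cancel_left _ (pow_pos hp.pos _)]

theorem exists_pow_eq_of_pow_eq_one (hK : Nat.card K = p ^ m) {a : ℕ} (ha : a ≤ m) {x : K}
    (hx : x ^ p ^ a = 1) : ∃ y : K, y ^ p ^ (m - a) = x := by
  have hp := Fact.out (p := p.Prime)
  obtain ⟨g, hg⟩ := IsCyclic.exists_generator (α := K)
  obtain ⟨k, rfl⟩ := Subgroup.mem_zpowers_iff.1 (hg x)
  have hgo : orderOf g = p ^ m := by
    rw [orderOf_eq_card_of_forall_mem_zpowers hg, hK]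
  rw [← zpow_natCast, ← zpow_mul, ← orderOf_dvd_iff_zpow_eq_one, hgo] at hx
  have hm : p ^ m = p ^ (m - a) * p ^ a := by rw [← pow_add, Nat.sub_add_cancel ha]
  rw [hm, Nat.cast_mul] at hx
  obtain ⟨c, rfl⟩ := Int.dvd_of_mul_dvd_mul_right
    (by exact_mod_cast pow_ne_zero a hp.ne_zero) hx
  refine ⟨g ^ c, ?_⟩
  rw [← zpow_natCast, ← zpow_mul, mul_comm]

/-- Let u have order p^a with a > 0. If u⁻¹x has smaller order, then x and u have the same
p^(a-1)-th power, so u⁻²x has order p^a; and so does u², p being odd. -/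
theorem exists_orderOf_eq_orderOf_inv_mul_eq (hp2 : p ≠ 2) (hK : Nat.card K = p ^ m) {a : ℕ}
    (ha : a ≤ m) {x : K} (hx : x ^ p ^ a = 1) :
    ∃ y : K, orderOf y = p ^ a ∧ orderOf (y⁻¹ * x) = p ^ a := by
  have hp := Fact.out (p := p.Prime)
  obtain ⟨u, hu⟩ := exists_orderOf_eq_prime_pow hK ha
  rcases a with _ | b
  · refine ⟨1, by simp, ?_⟩
    simpa using hx
  have hu1 : u ^ p ^ (b + 1) = 1 := hu ▸ pow_orderOf_eq_one u
  have hu0 : u ^ p ^ b ≠ 1 := by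
    intro h
    have := Nat.le_of_dvd (pow_pos hp.pos _) (hu ▸ orderOf_dvd_of_pow_eq_one h)
    exact absurd ((Nat.pow_le_pow_iff_right hp.one_lt).1 this) (by omega)
  by_cases h : (u⁻¹ * x) ^ p ^ b = 1
  · have hxu : x ^ p ^ b = u ^ p ^ b := by
      rw [mul_pow, inv_pow, inv_mul_eq_one] at h
      exact h.symm
    refine ⟨u ^ 2, ?_, orderOf_eq_prime_pow ?_ ?_⟩
    · rw [Nat.Coprime.orderOf_pow, hu]
      rw [hu]
      exact Nat.Coprime.pow_left _ ((Nat.coprime_primes hp Nat.prime_two).2 hp2)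
    · rw [mul_pow, hxu, inv_pow, pow_right_comm, sq, mul_inv, inv_mul_cancel_right, inv_eq_one]
      exact hu0
    · rw [mul_pow, hx, inv_pow, pow_right_comm, hu1]
      simp
  · refine ⟨u, hu, orderOf_eq_prime_pow h ?_⟩
    rw [mul_pow, hx, inv_pow, hu1]
    simp

end CyclicPGroup

/-! ### Boxes of torsion elements as characteristic subgroups -/

section OddPowerGroup

variable (p : ℕ) {n : ℕ}

theorem card_multiplicative_zmod (m : ℕ) :
    Nat.card (Multiplicative (ZMod m)) = m := by
  rw [Nat.card_congr Multiplicative.toAdd, Nat.card_zmod]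

/-- The subgroup of the elements of `Z_p × Z_{p^3} × ⋯ × Z_{p^{2n-1}}` whose `i`-th coordinate
has order dividing `p ^ a i`. -/
def torsionBox (a : Fin n → ℕ) : Subgroup (OddPowerGroup p n) :=
  Subgroup.pi Set.univ fun i =>
    (powMonoidHom (p ^ a i) : Multiplicative (ZMod (p ^ (2 * (i : ℕ) + 1))) →* _).ker

variable {p}

theorem mem_torsionBox {a : Fin n → ℕ} {x : OddPowerGroup p n} :
    x ∈ torsionBox p a ↔ ∀ i, x i ^ p ^ a i = 1 := by
  simp only [torsionBox, Subgroup.mem_pi, Set.mem_univ, true_imp_iff]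
  rfl

theorem pow_prime_pow_of_le {K : Type*} [Monoid K] {x : K} {a b : ℕ} (hab : a ≤ b)
    (h : x ^ p ^ a = 1) : x ^ p ^ b = 1 :=
  orderOf_dvd_iff_pow_eq_one.1 ((orderOf_dvd_of_pow_eq_one h).trans (pow_dvd_pow p hab))

theorem isPGroup_oddPowerGroup : IsPGroup p (OddPowerGroup p n) := by
  refine IsPGroup.of_card (n := ∑ i : Fin n, (2 * (i : ℕ) + 1)) ?_
  rw [Nat.card_pi, ← Finset.prod_pow_eq_pow_sum]
  exact Finset.prod_congr rfl fun i _ => card_multiplicative_zmod _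

theorem torsionBox_mono {a b : Fin n → ℕ} (hab : a ≤ b) : torsionBox p a ≤ torsionBox p b :=
  fun _ hx => mem_torsionBox.2 fun i => pow_prime_pow_of_le (hab i) (mem_torsionBox.1 hx i)

theorem torsionBox_sup (a b : Fin n → ℕ) :
    torsionBox p (a ⊔ b) = torsionBox p a ⊔ torsionBox p b := by
  refine le_antisymm (fun x hx => ?_)
    (sup_le (torsionBox_mono le_sup_left) (torsionBox_mono le_sup_right))
  rw [mem_torsionBox] at hx
  -- Each coordinate of x goes entirely to the factor with the larger exponent.
  refine Subgroup.mem_sup.2 ⟨fun i => if b i ≤ a i then x i else 1, mem_torsionBox.2 fun i => ?_,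
    fun i => if b i ≤ a i then 1 else x i, mem_torsionBox.2 fun i => ?_, ?_⟩
  · have := hx i
    split_ifs with h
    · rwa [Pi.sup_apply, sup_of_le_left h] at this
    · simp
  · have := hx i
    split_ifs with h
    · simp
    · rwa [Pi.sup_apply, sup_of_le_right (le_of_not_ge h)] at this
  · ext i
    simp only [Pi.mul_apply]
    split_ifs <;> simp

theorem torsionBox_inf (a b : Fin n → ℕ) :
    torsionBox p (a ⊓ b) = torsionBox p a ⊓ torsionBox p b := by
  refine le_antisymm (le_inf (torsionBox_mono inf_le_left) (torsionBox_mono inf_le_right))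
    fun x hx => mem_torsionBox.2 fun i => ?_
  rcases le_total (a i) (b i) with h | h
  · rw [Pi.inf_apply, inf_of_le_left h]
    exact mem_torsionBox.1 hx.1 i
  · rw [Pi.inf_apply, inf_of_le_right h]
    exact mem_torsionBox.1 hx.2 i

theorem torsionBox_zero : torsionBox p (0 : Fin n → ℕ) = ⊥ := by
  ext x
  rw [mem_torsionBox, Subgroup.mem_bot, funext_iff]
  simp

theorem torsionBox_eq_top : torsionBox p (fun i : Fin n => 2 * (i : ℕ) + 1) = ⊤ := by
  refine eq_top_iff.2 fun x _ => mem_torsionBox.2 fun i => ?_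
  have := pow_card_eq_one' (x := x i)
  rwa [card_multiplicative_zmod] at this

variable {D : Type*} [DistribLattice D] [BoundedOrder D]

variable (p) in
/-- The lattice homomorphism to subgroups given by a lattice homomorphism to exponent vectors. -/
def torsionBoxHom (E : LatticeHom D (Fin n → ℕ)) (hbot : E ⊥ = 0)
    (htop : E ⊤ = fun i : Fin n => 2 * (i : ℕ) + 1) :
    BoundedLatticeHom D (Subgroup (OddPowerGroup p n)) where
  toFun d := torsionBox p (E d)
  map_sup' d e := by rw [map_sup, torsionBox_sup]
  map_inf' d e := by rw [map_inf, torsionBox_inf]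
  map_top' := by rw [htop, torsionBox_eq_top]
  map_bot' := by rw [hbot, torsionBox_zero]

theorem torsionBoxHom_apply (E : LatticeHom D (Fin n → ℕ)) (hbot : E ⊥ = 0)
    (htop : E ⊤ = fun i : Fin n => 2 * (i : ℕ) + 1) (d : D) :
    torsionBoxHom p E hbot htop d = torsionBox p (E d) := rfl

variable [Fact p.Prime]

theorem card_torsionBox {a : Fin n → ℕ} (ha : ∀ i : Fin n, a i ≤ 2 * (i : ℕ) + 1) :
    Nat.card (torsionBox p a) = p ^ ∑ i, a i := by
  have e : torsionBox p a ≃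
      ((i : Fin n) → {z : Multiplicative (ZMod (p ^ (2 * (i : ℕ) + 1))) // z ^ p ^ a i = 1}) :=
    (Equiv.subtypeEquivRight fun x => mem_torsionBox).trans
      (Equiv.subtypePiEquivPi
        (p := fun (i : Fin n) (z : Multiplicative (ZMod (p ^ (2 * (i : ℕ) + 1)))) => z ^ p ^ a i = 1))
  rw [Nat.card_congr e, Nat.card_pi, ← Finset.prod_pow_eq_pow_sum]
  refine Finset.prod_congr rfl fun i _ => ?_
  change Nat.card (powMonoidHom (p ^ a i) :
    Multiplicative (ZMod (p ^ (2 * (i : ℕ) + 1))) →* _).ker = _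
  rw [IsCyclic.card_powMonoidHom_ker, card_multiplicative_zmod,
    Nat.gcd_eq_right (pow_dvd_pow p (ha i))]

/-- It suffices to follow a single x i into coordinate j of its image. If j ≥ i, monotonicity is
enough. If j < i, then x i is a p^(2i+1 - a i)-th power, and `hstep` gives 2i + 1 - a i + a j ≥ 2j +
1, an exponent that kills the j-th factor. -/
theorem characteristic_torsionBox {a : Fin n → ℕ} (ha : ∀ i : Fin n, a i ≤ 2 * (i : ℕ) + 1)
    (hmono : ∀ i j, i < j → a i ≤ a j)
    (hstep : ∀ i j : Fin n, i < j → a j + 2 * (i : ℕ) ≤ a i + 2 * (j : ℕ)) :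
    (torsionBox p a).Characteristic := by
  classical
  rw [Subgroup.characteristic_iff_le_comap]
  intro φ x hx
  rw [mem_torsionBox] at hx
  rw [Subgroup.mem_comap, ← Finset.univ_prod_mulSingle x, map_prod]
  refine Subgroup.prod_mem _ fun i _ => mem_torsionBox.2 fun j => ?_
  rw [← Pi.pow_apply, MulEquiv.coe_toMonoidHom, ← map_pow]
  rcases lt_or_ge j i with hji | hij
  · obtain ⟨y, hy⟩ := exists_pow_eq_of_pow_eq_one (card_multiplicative_zmod _) (ha i) (hx i)
    rw [← hy, Pi.mulSingle_pow, ← pow_mul, ← pow_add, map_pow, Pi.pow_apply]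
    refine pow_prime_pow_of_le (a := 2 * (j : ℕ) + 1) ?_ ?_
    · have := hstep j i hji
      have := ha i
      omega
    · exact mem_torsionBox.1 (torsionBox_eq_top (p := p) (n := n) ▸ Subgroup.mem_top _) j
  · have : x i ^ p ^ a j = 1 := by
      rcases hij.eq_or_lt with rfl | hlt
      · exact hx i
      · exact pow_prime_pow_of_le (hmono i j hlt) (hx i)
    rw [← Pi.mulSingle_pow, this, Pi.mulSingle_one, map_one, Pi.one_apply]

theorem mem_layer_torsionBoxHom (E : LatticeHom D (Fin n → ℕ)) (hbot : E ⊥ = 0)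
    (htop : E ⊤ = fun i : Fin n => 2 * (i : ℕ) + 1) (hinj : Function.Injective E) {d : D}
    {x : OddPowerGroup p n} (hx : ∀ i, orderOf (x i) = p ^ E d i) :
    x ∈ layer (torsionBoxHom p E hbot htop) d := by
  intro e
  have hle : d ≤ e ↔ E d ≤ E e := by
    rw [← inf_eq_left, ← inf_eq_left, ← map_inf, hinj.eq_iff]
  rw [torsionBoxHom_apply, mem_torsionBox, hle, Pi.le_def]
  refine forall_congr' fun i => ?_
  rw [← orderOf_dvd_iff_pow_eq_one, hx,
    Nat.pow_dvd_pow_iff_le_right (Fact.out (p := p.Prime)).one_lt]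

theorem exists_mem_layer_torsionBoxHom (hp : p ≠ 2) (E : LatticeHom D (Fin n → ℕ))
    (hbot : E ⊥ = 0) (htop : E ⊤ = fun i : Fin n => 2 * (i : ℕ) + 1)
    (hinj : Function.Injective E) (d : D) (x : OddPowerGroup p n)
    (hx : x ∈ torsionBoxHom p E hbot htop d) :
    ∃ g ∈ layer (torsionBoxHom p E hbot htop) d,
      g⁻¹ * x ∈ layer (torsionBoxHom p E hbot htop) d := by
  have hle : ∀ i : Fin n, E d i ≤ 2 * (i : ℕ) + 1 := by
    have := OrderHomClass.mono E (le_top (a := d))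
    rwa [htop] at this
  rw [torsionBoxHom_apply, mem_torsionBox] at hx
  choose y hy hyx using fun i => exists_orderOf_eq_orderOf_inv_mul_eq hp
    (card_multiplicative_zmod _) (hle i) (hx i)
  exact ⟨y, mem_layer_torsionBoxHom E hbot htop hinj hy,
    mem_layer_torsionBoxHom E hbot htop hinj hyx⟩

end OddPowerGroup
end SRing
end

noncomputable section

namespace SRing

/-! ### Automorphisms of a finite poset and of its lower sets -/

section LowerSetAutomorphisms

variable {Y : Type*} [PartialOrder Y]

/-- An automorphism of a partial order acts on its lattice of lower sets. -/
def lowerSetAutomorphismHom : (Y ≃o Y) →* (LowerSet Y ≃o LowerSet Y) :=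
  MonoidHom.mk' LowerSet.map fun σ τ => by
    ext U : 2
    exact (LowerSet.map_map σ τ (s := U)).symm

theorem injective_lowerSetAutomorphismHom :
    Function.Injective (lowerSetAutomorphismHom (Y := Y)) := by
  intro σ τ h
  ext y
  have h1 : LowerSet.map σ (LowerSet.Iic y) = LowerSet.map τ (LowerSet.Iic y) :=
    DFunLike.congr_fun h _
  rw [LowerSet.map_Iic, LowerSet.map_Iic] at h1
  exact LowerSet.Iic_injective h1

/-- Lattice automorphisms preserve sup-irreducibility, and the sup-irreducible lower sets are the
principal ones. A lower set is determined by the principal ones it contains. -/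
theorem surjective_lowerSetAutomorphismHom [Finite Y] :
    Function.Surjective (lowerSetAutomorphismHom (Y := Y)) := by
  intro σ
  have h : ∀ y, ∃ z, LowerSet.Iic z = σ (LowerSet.Iic y) := by
    intro y
    rw [← LowerSet.supIrred_iff_of_finite]
    refine ⟨fun h => (LowerSet.supIrred_Iic y).1 ?_, fun A B hAB => ?_⟩
    · rw [isMin_iff_eq_bot] at h ⊢
      exact σ.injective (h.trans (map_bot σ).symm)
    · have h1 : σ.symm A ⊔ σ.symm B = LowerSet.Iic y := by
        rw [← map_sup, hAB, OrderIso.symm_apply_apply]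
      rcases (LowerSet.supIrred_Iic y).2 h1 with h | h
      · exact Or.inl (by rw [← h, OrderIso.apply_symm_apply])
      · exact Or.inr (by rw [← h, OrderIso.apply_symm_apply])
  choose f hf using h
  have hle : ∀ a b, f a ≤ f b ↔ a ≤ b := by
    intro a b
    rw [← LowerSet.mem_Iic_iff (b := f a), ← LowerSet.Iic_le, hf, hf, OrderIso.le_iff_le,
      LowerSet.Iic_le, LowerSet.mem_Iic_iff]
  have hinj : Function.Injective f := fun a b hab =>
    le_antisymm ((hle a b).1 hab.le) ((hle b a).1 hab.ge)
  let τ : Y ≃o Y :=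
    ⟨Equiv.ofBijective f (Finite.injective_iff_bijective.1 hinj), fun {a b} => hle a b⟩
  refine ⟨τ, ?_⟩
  ext U z
  obtain ⟨y, rfl⟩ := τ.surjective z
  change τ y ∈ LowerSet.map τ U ↔ τ y ∈ σ U
  rw [LowerSet.mem_map, OrderIso.symm_apply_apply]
  change _ ↔ f y ∈ σ U
  rw [← LowerSet.Iic_le, ← LowerSet.Iic_le, hf, OrderIso.le_iff_le]

end LowerSetAutomorphisms

/-! ### Exponent vectors of lower sets -/

section Exponents

open scoped Classical

variable {Y : Type*} [PartialOrder Y] [BoundedOrder Y] {n : ℕ}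

/-- The exponent vector attached to a lower set, given an enumeration of the elements of the
poset other than the least and the greatest one. -/
def lowerSetExponent (e : Fin n ≃ {y : Y // y ≠ ⊥ ∧ y ≠ ⊤}) :
    LatticeHom (LowerSet Y) (Fin n → ℕ) where
  -- The least lower set is empty and must give 0, whereas `{⊥}` gives the vector i; only the whole
  -- poset contains `⊤`.
  toFun U i := if ⊤ ∈ U then 2 * (i : ℕ) + 1 else if ⊥ ∈ U then
    (i : ℕ) + (if (e i : Y) ∈ U then 1 else 0) else 0
  map_sup' U V := by
    ext i
    have hU : ⊤ ∈ U → ⊥ ∈ U := fun h => U.lower bot_le h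
    have hV : ⊤ ∈ V → ⊥ ∈ V := fun h => V.lower bot_le h
    have hU' : (e i : Y) ∈ U → ⊥ ∈ U := fun h => U.lower bot_le h
    have hV' : (e i : Y) ∈ V → ⊥ ∈ V := fun h => V.lower bot_le h
    simp only [Pi.sup_apply, LowerSet.mem_sup_iff]
    grind
  map_inf' U V := by
    ext i
    have hU : ⊤ ∈ U → (e i : Y) ∈ U := fun h => U.lower le_top h
    have hV : ⊤ ∈ V → (e i : Y) ∈ V := fun h => V.lower le_top h
    have hU' : (e i : Y) ∈ U → ⊥ ∈ U := fun h => U.lower bot_le h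
    have hV' : (e i : Y) ∈ V → ⊥ ∈ V := fun h => V.lower bot_le h
    simp only [Pi.inf_apply, LowerSet.mem_inf_iff]
    grind

variable (e : Fin n ≃ {y : Y // y ≠ ⊥ ∧ y ≠ ⊤})

theorem lowerSetExponent_apply (U : LowerSet Y) (i : Fin n) :
    lowerSetExponent e U i = if ⊤ ∈ U then 2 * (i : ℕ) + 1 else if ⊥ ∈ U then
      (i : ℕ) + (if (e i : Y) ∈ U then 1 else 0) else 0 := rfl

theorem lowerSetExponent_bot : lowerSetExponent e ⊥ = 0 := by
  ext i
  simp [lowerSetExponent_apply]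

theorem lowerSetExponent_top :
    lowerSetExponent e ⊤ = fun i : Fin n => 2 * (i : ℕ) + 1 := by
  ext i
  simp [lowerSetExponent_apply]

theorem injective_lowerSetExponent (hn : 2 ≤ n) :
    Function.Injective (lowerSetExponent e) := by
  intro U V h
  -- Coordinate 1 tells the three cases apart, with values 0, then 1 or 2, then 3; in coordinate 0
  -- their values overlap.
  have h1 := congrFun h ⟨1, hn⟩
  simp only [lowerSetExponent_apply] at h1
  have hU : ⊤ ∈ U → ⊥ ∈ U := fun h => U.lower bot_le h
  have hV : ⊤ ∈ V → ⊥ ∈ V := fun h => V.lower bot_le h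
  have htop : ⊤ ∈ U ↔ ⊤ ∈ V := by grind
  have hbot : ⊥ ∈ U ↔ ⊥ ∈ V := by grind
  ext y
  change y ∈ U ↔ y ∈ V
  by_cases hyt : y = ⊤
  · rwa [hyt]
  by_cases hyb : y = ⊥
  · rwa [hyb]
  have h2 := congrFun h (e.symm ⟨y, hyb, hyt⟩)
  simp only [lowerSetExponent_apply, Equiv.apply_symm_apply] at h2
  have hU1 : ⊤ ∈ U → y ∈ U := fun h => U.lower le_top h
  have hV1 : ⊤ ∈ V → y ∈ V := fun h => V.lower le_top h
  have hU2 : y ∈ U → ⊥ ∈ U := fun h => U.lower bot_le h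
  have hV2 : y ∈ V → ⊥ ∈ V := fun h => V.lower bot_le h
  grind

theorem lowerSetExponent_le (U : LowerSet Y) (i : Fin n) :
    lowerSetExponent e U i ≤ 2 * (i : ℕ) + 1 := by
  rw [lowerSetExponent_apply]
  split_ifs <;> omega

theorem lowerSetExponent_mono (U : LowerSet Y) (i j : Fin n) (hij : i < j) :
    lowerSetExponent e U i ≤ lowerSetExponent e U j := by
  have : (i : ℕ) < j := hij
  simp only [lowerSetExponent_apply]
  split_ifs <;> omega

/-- In the middle case the bound is (j + 1) - i ≤ 2(j - i), valid since j - i ≥ 1. -/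
theorem lowerSetExponent_step (U : LowerSet Y) (i j : Fin n) (hij : i < j) :
    lowerSetExponent e U j + 2 * (i : ℕ) ≤ lowerSetExponent e U i + 2 * (j : ℕ) := by
  have : (i : ℕ) < j := hij
  simp only [lowerSetExponent_apply]
  split_ifs <;> omega

/-- In the middle case the sum is a constant plus the number of inner elements in U, and τ permutes
the inner elements. -/
theorem sum_lowerSetExponent_map (τ : Y ≃o Y) (U : LowerSet Y) :
    ∑ i, lowerSetExponent e (LowerSet.map τ U) i = ∑ i, lowerSetExponent e U i := by
  have hbot : τ.symm ⊥ = ⊥ := map_bot _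
  have htop : τ.symm ⊤ = ⊤ := map_top _
  have hτ : ∀ y : Y, (y ≠ ⊥ ∧ y ≠ ⊤) ↔ (τ.symm y ≠ ⊥ ∧ τ.symm y ≠ ⊤) := by
    intro y
    rw [← hbot, ← htop, τ.symm.injective.ne_iff, τ.symm.injective.ne_iff, hbot, htop]
  let π : Fin n ≃ Fin n := (e.trans (τ.symm.toEquiv.subtypeEquiv hτ)).trans e.symm
  have hπ : ∀ i, (e (π i) : Y) = τ.symm (e i) := by
    intro i
    simp [π]
  simp only [lowerSetExponent_apply, LowerSet.mem_map, hbot, htop]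
  split_ifs
  · rfl
  · rw [Finset.sum_add_distrib, Finset.sum_add_distrib]
    congr 1
    exact Finset.sum_equiv π (by simp) fun i _ => by rw [hπ]
  · rfl

end Exponents

/-! ### A finite bounded poset with prescribed automorphism group -/

section CayleyPoset

/-- A bounded partial order on which a linearly ordered group `Γ` acts as the full automorphism
group: the atoms are indexed by `Γ`, above them there is a chain for each element of `Γ`, and the
height at which the chain of `h` lies above the atom `g` is determined by `g⁻¹ * h`. -/
inductive CayleyPoset (Γ : Type*)
  | bot : CayleyPoset Γ
  | low : Γ → CayleyPoset Γ
  | high : Γ → Γ → CayleyPoset Γ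
  | top : CayleyPoset Γ

namespace CayleyPoset

variable {Γ : Type*} [Group Γ]

/-- Left translation of the poset. -/
def translate (k : Γ) : CayleyPoset Γ → CayleyPoset Γ
  | bot => bot
  | low g => low (k * g)
  | high h c => high (k * h) c
  | top => top

theorem translate_translate (k l : Γ) (x : CayleyPoset Γ) :
    translate k (translate l x) = translate (k * l) x := by
  cases x <;> simp [translate, mul_assoc]

theorem translate_one (x : CayleyPoset Γ) : translate 1 x = x := by
  cases x <;> simp [translate]

variable [LinearOrder Γ]

/-- The order relation of the poset. -/
def le : CayleyPoset Γ → CayleyPoset Γ → Prop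
  | bot, _ => True
  | _, top => True
  | low g, low g' => g = g'
  | low g, high h c => g⁻¹ * h ≤ c
  | high h c, high h' c' => h = h' ∧ c ≤ c'
  | _, _ => False

instance : PartialOrder (CayleyPoset Γ) where
  le := le
  le_refl x := by cases x <;> simp [le]
  le_trans x y z hxy hyz := by
    cases x <;> cases y <;> cases z <;> simp only [le] at * <;> grind
  le_antisymm x y hxy hyx := by
    cases x <;> cases y <;> simp only [le] at * <;> grind

instance : BoundedOrder (CayleyPoset Γ) where
  bot := bot
  top := top
  bot_le x := by cases x <;> trivial
  le_top x := by cases x <;> trivial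

theorem low_le_high {g h c : Γ} : low g ≤ high h c ↔ g⁻¹ * h ≤ c := Iff.rfl

theorem high_le_high {h c h' c' : Γ} : high h c ≤ high h' c' ↔ h = h' ∧ c ≤ c' := Iff.rfl

instance [Finite Γ] : Finite (CayleyPoset Γ) :=
  Finite.of_surjective
    (fun x : Option (Γ ⊕ Γ × Γ ⊕ Unit) => match x with
      | none => bot
      | some (.inl g) => low g
      | some (.inr (.inl (h, c))) => high h c
      | some (.inr (.inr ())) => top)
    (by
      rintro (_ | g | ⟨h, c⟩ | _)
      exacts [⟨none, rfl⟩, ⟨some (.inl g), rfl⟩, ⟨some (.inr (.inl (h, c))), rfl⟩,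
        ⟨some (.inr (.inr ())), rfl⟩])

theorem isAtom_iff {x : CayleyPoset Γ} : IsAtom x ↔ ∃ g, x = low g := by
  constructor
  · intro h
    rcases x with _ | g | ⟨k, c⟩ | _
    · exact absurd rfl h.1
    · exact ⟨g, rfl⟩
    · have h1 : low (k * c⁻¹) ≤ high k c := by simp [low_le_high]
      rcases h.le_iff.1 h1 with h2 | h2 <;> cases h2
    · have h1 : low 1 ≤ (top : CayleyPoset Γ) := le_top
      rcases h.le_iff.1 h1 with h2 | h2 <;> cases h2
  · rintro ⟨g, rfl⟩
    refine ⟨by rintro ⟨⟩, fun y hy => ?_⟩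
    rcases y with _ | g | ⟨k, c⟩ | _
    · rfl
    · cases (show _ = _ from hy.le)
      exact absurd hy (lt_irrefl _)
    · exact hy.le.elim
    · exact hy.le.elim

theorem translate_le_iff (k : Γ) (x y : CayleyPoset Γ) :
    translate k x ≤ translate k y ↔ x ≤ y := by
  change le _ _ ↔ le _ _
  cases x <;> cases y <;> simp [translate, le, mul_assoc]

/-- The action of the group on the poset by left translations. -/
def translationHom : Γ →* (CayleyPoset Γ ≃o CayleyPoset Γ) :=
  MonoidHom.mk' (fun k =>
    { toFun := translate k
      invFun := translate k⁻¹
      left_inv := fun x => by rw [translate_translate, inv_mul_cancel, translate_one]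
      right_inv := fun x => by rw [translate_translate, mul_inv_cancel, translate_one]
      map_rel_iff' := fun {x y} => translate_le_iff k x y }) fun k l => by
    ext x
    exact (translate_translate k l x).symm

theorem translationHom_apply (k : Γ) (x : CayleyPoset Γ) : translationHom k x = translate k x :=
  rfl

theorem injective_translationHom : Function.Injective (translationHom (Γ := Γ)) := by
  intro k l h
  have := DFunLike.congr_fun h (low 1)
  simpa [translationHom_apply, translate] using this

/-- Automorphisms permute the atoms (by α) and the chains (by π), and fix heights because a finite
linear order is rigid. Comparing the least height at which chain h lies above atom g yields g⁻¹h =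
α(g)⁻¹π(h). The cases g = 1 and g = h show that π and α are both left multiplication by α(1). -/
theorem surjective_translationHom [Finite Γ] : Function.Surjective (translationHom (Γ := Γ)) := by
  intro φ
  have hlow : ∀ g, ∃ g', φ (low g) = low g' := fun g =>
    isAtom_iff.1 ((φ.isAtom_iff _).2 (isAtom_iff.2 ⟨g, rfl⟩))
  have hhigh : ∀ h c, ∃ h' c', φ (high h c) = high h' c' := by
    intro h c
    rcases hx : φ (high h c) with _ | g | ⟨h', c'⟩ | _
    · cases φ.injective (hx.trans (map_bot φ).symm)
    · have := (φ.isAtom_iff _).1 (isAtom_iff.2 ⟨g, hx⟩)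
      obtain ⟨_, h1⟩ := isAtom_iff.1 this
      cases h1
    · exact ⟨h', c', rfl⟩
    · cases φ.injective (hx.trans (map_top φ).symm)
  choose α hα using hlow
  choose π κ hπ using hhigh
  have hle : ∀ h c c', c ≤ c' → π h c = π h c' ∧ κ h c ≤ κ h c' := by
    intro h c c' hcc
    have h1 : φ (high h c) ≤ φ (high h c') := φ.monotone (high_le_high.2 ⟨rfl, hcc⟩)
    rwa [hπ, hπ] at h1
  have hπc : ∀ h c, π h c = π h 1 := by
    intro h c
    rcases le_total c 1 with hc | hc
    · exact (hle h c 1 hc).1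
    · exact (hle h 1 c hc).1.symm
  have hκ : ∀ h c, κ h c = c := by
    intro h c
    -- As π h does not depend on the height, injectivity of φ passes to κ h.
    have hm : StrictMono (κ h) := by
      refine Monotone.strictMono_of_injective (fun c c' hc => (hle h c c' hc).2) fun c c' hc => ?_
      have : φ (high h c) = φ (high h c') := by rw [hπ, hπ, hπc, hπc h c', hc]
      cases φ.injective this
      rfl
    exact le_antisymm hm.apply_le hm.le_apply
  have hφ : ∀ h c, φ (high h c) = high (π h 1) c := by
    intro h c
    rw [hπ, hπc, hκ]
  have key : ∀ g h, g⁻¹ * h = (α g)⁻¹ * π h 1 := by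
    intro g h
    have h1 : ∀ c, g⁻¹ * h ≤ c ↔ (α g)⁻¹ * π h 1 ≤ c := by
      intro c
      rw [← low_le_high, ← low_le_high, ← hα, ← hφ, φ.le_iff_le]
    exact le_antisymm ((h1 _).2 le_rfl) ((h1 _).1 le_rfl)
  have hπ1 : ∀ h, π h 1 = α 1 * h := by
    intro h
    have := key 1 h
    rw [eq_inv_mul_iff_mul_eq] at this
    rw [← this]
    simp
  have hα1 : ∀ g, α g = α 1 * g := by
    intro g
    have := key g g
    rw [inv_mul_cancel, hπ1, eq_comm, inv_mul_eq_one] at this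
    exact this
  refine ⟨α 1, ?_⟩
  ext x
  rw [translationHom_apply]
  rcases x with _ | g | ⟨h, c⟩ | _
  · exact (map_bot φ).symm
  · rw [hα, hα1 g]
    rfl
  · rw [hφ, hπ1]
    rfl
  · exact (map_top φ).symm

end CayleyPoset

end CayleyPoset

end SRing
end

theorem mainTheorem1 (p : ℕ) [Fact p.Prime] (hp : p ≠ 2)
    (F : Type*) [Field F] [CharZero F] (Γ : Type*) [Group Γ] [Finite Γ] :
    ∃ (n : ℕ) (_ : 1 ≤ n) (D : Type) (_ : DistribLattice D) (_ : BoundedOrder D) (_ : Finite D)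
      (ι : BoundedLatticeHom D (Subgroup (SRing.OddPowerGroup p n)))
      (S : SRing.SchurRing F (SRing.OddPowerGroup p n)),
      IsPGroup p (SRing.OddPowerGroup p n) ∧
      Nonempty ((D ≃o D) ≃* Γ) ∧
      Function.Injective ι ∧
      (∀ d, (ι d).Characteristic) ∧
      Subalgebra.toSubmodule S.toSubalgebra =
        Submodule.span F (Set.range fun d =>
          SRing.simpleQuantity F (ι d : Set (SRing.OddPowerGroup p n))) ∧
      S.IsRational ∧
      Nonempty (S.automorphismGroup ≃* Γ) := by
  -- D must live in `Type`, hence the small copy of Γ. The linear order is arbitrary and need not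
  -- respect multiplication.
  let _ : LinearOrder (Shrink.{0} Γ) :=
    LinearOrder.lift' (Finite.equivFin (Shrink.{0} Γ)) (Equiv.injective _)
  let Y := SRing.CayleyPoset (Shrink.{0} Γ)
  have : Finite (LowerSet Y) := Finite.of_injective _ SetLike.coe_injective
  let M := {y : Y // y ≠ ⊥ ∧ y ≠ ⊤}
  let e : Fin (Nat.card M) ≃ M := (Finite.equivFin M).symm
  have hn : 2 ≤ Nat.card M := by
    -- Even for trivial Γ there are two inner elements, an atom and a chain element.
    have : Nontrivial M :=
      ⟨⟨.low 1, by rintro ⟨⟩, by rintro ⟨⟩⟩, ⟨.high 1 1, by rintro ⟨⟩, by rintro ⟨⟩⟩,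
        fun h => by cases congrArg Subtype.val h⟩
    exact Finite.one_lt_card
  let ι := SRing.torsionBoxHom p (SRing.lowerSetExponent e) (SRing.lowerSetExponent_bot e)
    (SRing.lowerSetExponent_top e)
  have hgen : ∀ d, ∀ x ∈ ι d, ∃ g ∈ SRing.layer ι d, g⁻¹ * x ∈ SRing.layer ι d :=
    SRing.exists_mem_layer_torsionBoxHom hp _ _ _ (SRing.injective_lowerSetExponent e hn)
  -- Factoring 1 already exhibits an element of the layer.
  have hne : ∀ d, (SRing.layer ι d).Nonempty := fun d =>
    let ⟨g, hg, _⟩ := hgen d 1 (one_mem _)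
    ⟨g, hg⟩
  have hchar : ∀ d, (ι d).Characteristic := fun U =>
    SRing.characteristic_torsionBox (SRing.lowerSetExponent_le e U)
      (SRing.lowerSetExponent_mono e U) (SRing.lowerSetExponent_step e U)
  have hcard : ∀ (σ : LowerSet Y ≃o LowerSet Y) U, Nat.card (ι (σ U)) = Nat.card (ι U) := by
    intro σ U
    obtain ⟨τ, rfl⟩ := SRing.surjective_lowerSetAutomorphismHom σ
    change Nat.card (SRing.torsionBox p _) = Nat.card (SRing.torsionBox p _)
    rw [SRing.card_torsionBox (SRing.lowerSetExponent_le e _),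
      SRing.card_torsionBox (SRing.lowerSetExponent_le e _)]
    exact congrArg (p ^ ·) (SRing.sum_lowerSetExponent_map e τ U)
  let f₁ : Shrink.{0} Γ ≃* (Y ≃o Y) := MulEquiv.ofBijective SRing.CayleyPoset.translationHom
    ⟨SRing.CayleyPoset.injective_translationHom, SRing.CayleyPoset.surjective_translationHom⟩
  let f₂ : (Y ≃o Y) ≃* (LowerSet Y ≃o LowerSet Y) :=
    MulEquiv.ofBijective SRing.lowerSetAutomorphismHom
      ⟨SRing.injective_lowerSetAutomorphismHom, SRing.surjective_lowerSetAutomorphismHom⟩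
  let f₃ : (LowerSet Y ≃o LowerSet Y) ≃* (SRing.latticeSchurRing ι F hne).automorphismGroup :=
    MulEquiv.ofBijective (SRing.automorphismHom F hne hcard)
      ⟨SRing.injective_automorphismHom ι F hne hcard,
        SRing.surjective_automorphismHom ι F hne hcard hgen⟩
  let g : (LowerSet Y ≃o LowerSet Y) ≃* Γ := (f₁.trans f₂).symm.trans Shrink.mulEquiv
  exact ⟨Nat.card M, by omega, LowerSet Y, inferInstance, inferInstance, inferInstance, ι,
    SRing.latticeSchurRing ι F hne, SRing.isPGroup_oddPowerGroup, ⟨g⟩,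
    SRing.injective_of_layer_nonempty ι hne, hchar, SRing.toSubmodule_latticeSubalgebra ι F,
    SRing.isRational_latticeSchurRing ι F hne hchar, ⟨f₃.symm.trans g⟩⟩
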